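/- Let $(X,\mathcal B,m)$ be a $\sigma$-finite measure space with $m(X)=\infty$ and let $T:X\to X$ be an invertible (bi-measurable), conservative, ergodic, measure-preserving transformation. For $f:X\to\mathbb R$ and $n\ge 1$ write $\Sigma_n(f)(x)=\sum_{|k|<n} f(T^k x)$, the sum being over integers $k$. Let $(a_n)$ be a sequence of real numbers with $a_n\to\infty$, and let $0\le f\in L^1(X,m)$. Then for $m$-almost every $x\in X$ the following holds: if $$0<\liminf_{n\to\infty}\frac{\Sigma_n(f)(x)}{a_n}<\infty,$$ then $$\frac{\liminf_{n\to\infty}\Sigma_n(f)(x)/a_n}{\limsup_{n\to\infty}\Sigma_n(f)(x)/a_n}\le\frac{10001}{10002},$$ where the quotient is $0$ if the upper limit is $+\infty$. -/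

import Mathlib

open MeasureTheory Filter Topology

/-- The symmetric (two-sided) Birkhoff sum `Σ_n(f)(x) = ∑_{|k| < n} f (T^k x)` of an invertible
transformation `T`, the sum running over the integers `k` with `-n < k < n`. -/
noncomputable def symmBirkhoffSum {X : Type*} [MeasurableSpace X] (T : X ≃ᵐ X) (f : X → ℝ) (n : ℕ) (x : X) : ℝ :=
  ∑ k ∈ Finset.Ioo (-(n : ℤ)) (n : ℤ), f (((T.toEquiv : Equiv.Perm X) ^ k) x)

/-- The lower limit of `Σ_n(f)(x) / a_n`, as an extended real number. -/
noncomputable def lowerSymmLimit {X : Type*} [MeasurableSpace X] (T : X ≃ᵐ X) (f : X → ℝ)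
    (a : ℕ → ℝ) (x : X) : EReal :=
  liminf (fun n : ℕ => ((symmBirkhoffSum T f n x / a n : ℝ) : EReal)) atTop

/-- The upper limit of `Σ_n(f)(x) / a_n`, as an extended real number. -/
noncomputable def upperSymmLimit {X : Type*} [MeasurableSpace X] (T : X ≃ᵐ X) (f : X → ℝ)
    (a : ℕ → ℝ) (x : X) : EReal :=
  limsup (fun n : ℕ => ((symmBirkhoffSum T f n x / a n : ℝ) : EReal)) atTop

/-! Suppose that Σ_n(f) stays within a factor near 1 of a multiple of a_n on a set of positive
measure. The ratio ergodic theorem (`Ergodic.ae_exists_symmBirkhoffSum_le_add`) replaces f by the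
indicator of a set A of finite positive measure inside that set, with the factor relaxed to 9/8. Let
G ⊆ A be a large subset where the bounds are uniform, and V ⊆ G a subset around whose points A \ G
is sparse in A.

Infinite measure makes visits to A have zero density. Hence some point of V has a long past, of
length n, with at most a_n / 100 visits to A (`exists_birkhoffSum_indicator_le`). Otherwise the
visits to A on long excursions from V would be numerous enough to control all visits to V, although
the points of A on very long excursions form a set of small measure.

Such a gap is impossible (`not_gap_of_homogeneous`). Let F(t) count the visits to A in [0, t). As
the past is nearly empty, F(t) agrees with a_t for t ≤ n up to a factor 9/8 and an error a_n / 100.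
The window of radius p about a visit p to G is (0, 2p), so F(2p) is at most about 9/8 F(p), and two
doublings give at most about 81/64. But the window of radius s/2 about a visit s to G adds about 8/9
F(s/2) new visits to the first F(s/2), so F(2s) is at least 17/9 F(s/2). -/

section Maximal

/-! ### Maximal ergodic inequality and one-sided boundedness. -/

variable {X : Type*}

/-- `maxBirkhoff T h n x` is the maximum of the Birkhoff sums `birkhoffSum T h k x`, `k ≤ n`. -/
noncomputable def maxBirkhoff (T : X → X) (h : X → ℝ) : ℕ → X → ℝ
  | 0, _ => 0
  | n + 1, x => max 0 (h x + maxBirkhoff T h n (T x))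

lemma maxBirkhoff_succ (T : X → X) (h : X → ℝ) (n : ℕ) (x : X) :
    maxBirkhoff T h (n + 1) x = max 0 (h x + maxBirkhoff T h n (T x)) := rfl

lemma maxBirkhoff_nonneg (T : X → X) (h : X → ℝ) (n : ℕ) (x : X) : 0 ≤ maxBirkhoff T h n x := by
  cases n with
  | zero => exact le_rfl
  | succ n => exact le_max_left _ _

lemma maxBirkhoff_le_succ (T : X → X) (h : X → ℝ) (n : ℕ) (x : X) :
    maxBirkhoff T h n x ≤ maxBirkhoff T h (n + 1) x := by
  induction n generalizing x with
  | zero => exact maxBirkhoff_nonneg _ _ _ _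
  | succ n ih =>
    rw [maxBirkhoff_succ, maxBirkhoff_succ T h (n + 1)]
    gcongr
    exact ih _

lemma birkhoffSum_le_maxBirkhoff (T : X → X) (h : X → ℝ) (n : ℕ) (x : X) :
    birkhoffSum T h n x ≤ maxBirkhoff T h n x := by
  induction n generalizing x with
  | zero => simp [maxBirkhoff]
  | succ n ih =>
    rw [birkhoffSum_succ', maxBirkhoff_succ]
    exact le_max_of_le_right (by gcongr; exact ih _)

variable [MeasurableSpace X] {μ : Measure X} {T : X → X} {h : X → ℝ}

lemma measurable_maxBirkhoff (hT : Measurable T) (hh : Measurable h) (n : ℕ) :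
    Measurable (maxBirkhoff T h n) := by
  induction n with
  | zero => exact measurable_const
  | succ n ih => exact measurable_const.max (hh.add (ih.comp hT))

lemma integrable_maxBirkhoff (hT : MeasurePreserving T μ μ) (hi : Integrable h μ) (n : ℕ) :
    Integrable (maxBirkhoff T h n) μ := by
  induction n with
  | zero => exact integrable_zero _ _ _
  | succ n ih =>
    exact (integrable_zero X ℝ μ).sup (hi.add (hT.integrable_comp_of_integrable ih))

/-- The maximal ergodic inequality. -/
lemma setIntegral_maxBirkhoff_pos_nonneg (hT : MeasurePreserving T μ μ) (hh : Measurable h)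
    (hi : Integrable h μ) (n : ℕ) : 0 ≤ ∫ x in {x | 0 < maxBirkhoff T h n x}, h x ∂μ := by
  set E := {x | 0 < maxBirkhoff T h n x}
  have hE : MeasurableSet E :=
    measurableSet_lt measurable_const (measurable_maxBirkhoff hT.measurable hh n)
  have hM := integrable_maxBirkhoff hT hi n
  have hMT : Integrable (fun x => maxBirkhoff T h n (T x)) μ :=
    hT.integrable_comp_of_integrable hM
  have h0 : ∫ x, (maxBirkhoff T h n x - maxBirkhoff T h n (T x)) ∂μ = 0 := by
    rw [integral_sub hM hMT, sub_eq_zero]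
    have := integral_map (μ := μ) hT.measurable.aemeasurable (f := maxBirkhoff T h n)
      (by rw [hT.map_eq]; exact hM.aestronglyMeasurable)
    rw [hT.map_eq] at this
    exact this
  rw [← integral_indicator hE, ← h0]
  -- Garsia's argument: the integrand M_n - M_n ∘ T has integral 0. On E, h = M_n - M_{n-1} ∘ T
  -- dominates it; off E, M_n = 0 makes it nonpositive.
  refine integral_mono (hM.sub hMT) (hi.indicator hE) fun x => ?_
  by_cases hx : x ∈ E
  · rw [Set.indicator_of_mem hx]
    cases n with
    | zero => exact absurd (show (0 : ℝ) < 0 from hx) (lt_irrefl _)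
    | succ n =>
      have hx' : 0 < maxBirkhoff T h (n + 1) x := hx
      have h1 : maxBirkhoff T h (n + 1) x = h x + maxBirkhoff T h n (T x) := by
        rw [maxBirkhoff_succ] at hx' ⊢
        rcases lt_max_iff.1 hx' with h2 | h2
        · exact absurd h2 (lt_irrefl _)
        · exact max_eq_right h2.le
      have h2 := maxBirkhoff_le_succ T h n (T x)
      simp only
      linarith
  · rw [Set.indicator_of_notMem hx]
    have h1 : maxBirkhoff T h n x ≤ 0 := not_lt.1 hx
    have h2 := maxBirkhoff_nonneg T h n (T x)
    simp only
    linarith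

/-- For an ergodic map, Birkhoff sums of a function with negative integral are bounded above. -/
theorem Ergodic.ae_exists_birkhoffSum_le (hT : Ergodic T μ) (hh : Measurable h)
    (hi : Integrable h μ) (hneg : ∫ x, h x ∂μ < 0) :
    ∀ᵐ x ∂μ, ∃ K : ℝ, ∀ n, birkhoffSum T h n x ≤ K := by
  set B : Set X := {x | ∃ K : ℕ, ∀ n, maxBirkhoff T h n x ≤ K}
  have hBm : MeasurableSet B := by
    have : B = ⋃ K : ℕ, ⋂ n, {x | maxBirkhoff T h n x ≤ K} := by ext; simp [B]
    rw [this]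
    exact .iUnion fun K => .iInter fun n =>
      measurableSet_le (measurable_maxBirkhoff hT.measurable hh n) measurable_const
  have hBi : T ⁻¹' B = B := by
    ext x
    constructor
    · rintro ⟨K, hK⟩
      obtain ⟨K', hK'⟩ := exists_nat_ge (max 0 (h x + K))
      refine ⟨K', fun n => (maxBirkhoff_le_succ T h n x).trans (le_trans ?_ hK')⟩
      rw [maxBirkhoff_succ]
      gcongr
      exact hK n
    · rintro ⟨K, hK⟩
      obtain ⟨K', hK'⟩ := exists_nat_ge (K - h x)
      refine ⟨K', fun n => ?_⟩
      have := (le_max_right _ _).trans ((maxBirkhoff_succ T h n x).symm.le.trans (hK (n + 1)))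
      linarith
  rcases hT.toPreErgodic.ae_mem_or_ae_notMem hBm hBi with hB | hB
  · filter_upwards [hB] with x ⟨K, hK⟩
    exact ⟨K, fun n => (birkhoffSum_le_maxBirkhoff T h n x).trans (hK n)⟩
  · exfalso
    -- If almost every point lies outside B, the sets where the maximum is positive increase to
    -- almost all of X, and the maximal inequality passes to the limit ∫ h ≥ 0.
    have hmono : Monotone fun n => {x | 0 < maxBirkhoff T h n x} := by
      refine monotone_nat_of_le_succ fun n x hx => ?_
      exact lt_of_lt_of_le hx (maxBirkhoff_le_succ T h n x)
    have hlim := tendsto_setIntegral_of_monotone (μ := μ) (f := h)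
      (fun n => measurableSet_lt measurable_const
        (measurable_maxBirkhoff hT.measurable hh n)) hmono hi.integrableOn
    have hU : (⋃ n, {x | 0 < maxBirkhoff T h n x}) =ᵐ[μ] Set.univ := by
      rw [ae_eq_univ]
      refine measure_mono_null (fun x hx hxB => hx ?_) (measure_eq_zero_iff_ae_notMem.2 ?_)
        (t := {x | ¬ x ∉ B})
      · by_contra hcon
        refine hxB ⟨0, fun n => not_lt.1 fun hlt => hcon ?_⟩
        exact Set.mem_iUnion.2 ⟨n, by simpa using hlt⟩
      · filter_upwards [hB] with x hx
        simpa using hx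
    have := ge_of_tendsto' hlim
      fun n => setIntegral_maxBirkhoff_pos_nonneg hT.toMeasurePreserving hh hi n
    rw [setIntegral_congr_set hU, setIntegral_univ] at this
    linarith

end Maximal

/-! ### Two-sided orbits and the comparison of symmetric sums. -/

section Orbit

variable {X : Type*} [MeasurableSpace X]

/-- The point `T ^ k x` of the two-sided orbit of `x`. -/
def orbitPoint (T : X ≃ᵐ X) (k : ℤ) (x : X) : X := ((T.toEquiv : Equiv.Perm X) ^ k) x

lemma orbitPoint_add (T : X ≃ᵐ X) (i j : ℤ) (x : X) :
    orbitPoint T (i + j) x = orbitPoint T i (orbitPoint T j x) := by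
  simp [orbitPoint, zpow_add]

@[simp] lemma orbitPoint_zero (T : X ≃ᵐ X) (x : X) : orbitPoint T 0 x = x := by
  simp [orbitPoint]

lemma orbitPoint_natCast (T : X ≃ᵐ X) (n : ℕ) (x : X) : orbitPoint T n x = T^[n] x := by
  simp only [orbitPoint, zpow_natCast]
  rw [← Equiv.Perm.iterate_eq_pow]; rfl

lemma orbitPoint_neg (T : X ≃ᵐ X) (k : ℤ) (x : X) :
    orbitPoint T (-k) x = orbitPoint T.symm k x := by
  have : (T.symm.toEquiv : Equiv.Perm X) = (T.toEquiv : Equiv.Perm X)⁻¹ := rfl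
  simp [orbitPoint, this]

lemma orbitPoint_neg_natCast (T : X ≃ᵐ X) (n : ℕ) (x : X) :
    orbitPoint T (-n) x = T.symm^[n] x := by
  rw [orbitPoint_neg, orbitPoint_natCast]

lemma measurePreserving_orbitPoint {μ : Measure X} {T : X ≃ᵐ X} (hT : MeasurePreserving T μ μ)
    (k : ℤ) : MeasurePreserving (orbitPoint T k) μ μ := by
  obtain ⟨n, rfl | rfl⟩ := k.eq_nat_or_neg
  · rw [show orbitPoint T n = T^[n] from funext (orbitPoint_natCast T n)]
    exact hT.iterate n
  · rw [show orbitPoint T (-n) = T.symm^[n] from funext (orbitPoint_neg_natCast T n)]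
    exact (MeasurePreserving.symm T hT).iterate n

lemma symmBirkhoffSum_eq_sum_orbitPoint (T : X ≃ᵐ X) (f : X → ℝ) (n : ℕ) (x : X) :
    symmBirkhoffSum T f n x = ∑ k ∈ Finset.Ioo (-(n : ℤ)) n, f (orbitPoint T k x) := rfl

/-- Both one-sided sums contain the term k = 0, hence the extra `f x`. -/
lemma symmBirkhoffSum_succ (T : X ≃ᵐ X) (f : X → ℝ) (n : ℕ) (x : X) :
    symmBirkhoffSum T f (n + 1) x + f x =
      birkhoffSum T f (n + 1) x + birkhoffSum T.symm f (n + 1) x := by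
  induction n with
  | zero =>
    have : Finset.Ioo (-((0 + 1 : ℕ) : ℤ)) ((0 + 1 : ℕ) : ℤ) = {0} := by
      ext; simp; omega
    rw [symmBirkhoffSum_eq_sum_orbitPoint, this]
    simp
  | succ n ih =>
    have : Finset.Ioo (-((n + 1 + 1 : ℕ) : ℤ)) ((n + 1 + 1 : ℕ) : ℤ) =
        insert (-((n + 1 : ℕ) : ℤ)) (insert ((n + 1 : ℕ) : ℤ)
          (Finset.Ioo (-((n + 1 : ℕ) : ℤ)) ((n + 1 : ℕ) : ℤ))) := by
      ext; simp; omega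
    rw [symmBirkhoffSum_eq_sum_orbitPoint, this, Finset.sum_insert, Finset.sum_insert,
      ← symmBirkhoffSum_eq_sum_orbitPoint, birkhoffSum_succ T f (n + 1),
      birkhoffSum_succ T.symm f (n + 1), orbitPoint_natCast, orbitPoint_neg_natCast]
    · linarith
    · simp
    · simp; omega

lemma symmBirkhoffSum_zero (T : X ≃ᵐ X) (f : X → ℝ) (x : X) : symmBirkhoffSum T f 0 x = 0 := by
  simp [symmBirkhoffSum]

lemma symmBirkhoffSum_sub_smul (T : X ≃ᵐ X) (f g : X → ℝ) (c d : ℝ) (n : ℕ) (x : X) :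
    symmBirkhoffSum T (fun y => c * f y - d * g y) n x =
      c * symmBirkhoffSum T f n x - d * symmBirkhoffSum T g n x := by
  simp [symmBirkhoffSum, Finset.mul_sum]

lemma measurable_symmBirkhoffSum (T : X ≃ᵐ X) {f : X → ℝ} (hf : Measurable f) (n : ℕ) :
    Measurable (symmBirkhoffSum T f n) := by
  refine Finset.measurable_fun_sum _ fun k _ => hf.comp ?_
  change Measurable (orbitPoint T k)
  obtain ⟨m, rfl | rfl⟩ := k.eq_nat_or_neg
  · rw [show orbitPoint T m = T^[m] from funext (orbitPoint_natCast T m)]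
    exact T.measurable.iterate m
  · rw [show orbitPoint T (-m) = T.symm^[m] from funext (orbitPoint_neg_natCast T m)]
    exact T.symm.measurable.iterate m

theorem Ergodic.ae_exists_symmBirkhoffSum_le {μ : Measure X} {T : X ≃ᵐ X} (hT : Ergodic T μ)
    {h : X → ℝ} (hh : Measurable h) (hi : Integrable h μ) (hneg : ∫ x, h x ∂μ < 0) :
    ∀ᵐ x ∂μ, ∃ K : ℝ, ∀ n, symmBirkhoffSum T h n x ≤ K := by
  filter_upwards [hT.ae_exists_birkhoffSum_le hh hi hneg,
    hT.symm.ae_exists_birkhoffSum_le hh hi hneg] with x ⟨K, hK⟩ ⟨K', hK'⟩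
  refine ⟨max 0 (K + K' - h x), fun n => ?_⟩
  cases n with
  | zero => rw [symmBirkhoffSum_zero]; exact le_max_left _ _
  | succ n =>
    have := symmBirkhoffSum_succ T h n x
    have h1 := hK (n + 1)
    have h2 := hK' (n + 1)
    exact le_max_of_le_right (by linarith)

/-- Comparison of symmetric Birkhoff sums, a form of the ratio ergodic theorem. -/
theorem Ergodic.ae_exists_symmBirkhoffSum_le_add {μ : Measure X} {T : X ≃ᵐ X} (hT : Ergodic T μ)
    {f g : X → ℝ} (hf : Measurable f) (hg : Measurable g) (hfi : Integrable f μ)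
    (hgi : Integrable g μ) {c d : ℝ} (hneg : c * ∫ x, f x ∂μ < d * ∫ x, g x ∂μ) :
    ∀ᵐ x ∂μ, ∃ K : ℝ, ∀ n, c * symmBirkhoffSum T f n x ≤ d * symmBirkhoffSum T g n x + K := by
  have := hT.ae_exists_symmBirkhoffSum_le (h := fun y => c * f y - d * g y)
    ((hf.const_mul c).sub (hg.const_mul d)) ((hfi.const_mul c).sub (hgi.const_mul d)) (by
      rw [integral_sub (hfi.const_mul c) (hgi.const_mul d), integral_const_mul,
        integral_const_mul]
      linarith)
  filter_upwards [this] with x ⟨K, hK⟩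
  refine ⟨K, fun n => ?_⟩
  have := hK n
  rw [symmBirkhoffSum_sub_smul] at this
  linarith

theorem Ergodic.ae_exists_birkhoffSum_le_add {μ : Measure X} {T : X → X} (hT : Ergodic T μ)
    {f g : X → ℝ} (hf : Measurable f) (hg : Measurable g) (hfi : Integrable f μ)
    (hgi : Integrable g μ) {c d : ℝ} (hneg : c * ∫ x, f x ∂μ < d * ∫ x, g x ∂μ) :
    ∀ᵐ x ∂μ, ∃ K : ℝ, ∀ n, c * birkhoffSum T f n x ≤ d * birkhoffSum T g n x + K := by
  have := hT.ae_exists_birkhoffSum_le (h := fun y => c * f y - d * g y)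
    ((hf.const_mul c).sub (hg.const_mul d)) ((hfi.const_mul c).sub (hgi.const_mul d)) (by
      rw [integral_sub (hfi.const_mul c) (hgi.const_mul d), integral_const_mul,
        integral_const_mul]
      linarith)
  filter_upwards [this] with x ⟨K, hK⟩
  refine ⟨K, fun n => ?_⟩
  have h1 := hK n
  have h2 : birkhoffSum T (fun y => c * f y - d * g y) n x =
      c * birkhoffSum T f n x - d * birkhoffSum T g n x := by
    simp [birkhoffSum, Finset.mul_sum]
  linarith

lemma symmBirkhoffSum_congr_ae {μ : Measure X} {T : X ≃ᵐ X} (hT : MeasurePreserving T μ μ)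
    {f g : X → ℝ} (hfg : f =ᵐ[μ] g) :
    ∀ᵐ x ∂μ, ∀ n, symmBirkhoffSum T f n x = symmBirkhoffSum T g n x := by
  have : ∀ᵐ x ∂μ, ∀ k : ℤ, f (orbitPoint T k x) = g (orbitPoint T k x) :=
    ae_all_iff.2 fun k => (measurePreserving_orbitPoint hT k).quasiMeasurePreserving.ae hfg
  filter_upwards [this] with x hx n
  exact Finset.sum_congr rfl fun k _ => hx k

end Orbit

/-! ### Combinatorics of integer sets: homogeneity excludes a one-sided gap. -/

section Counting

/-- The number of points of `A` in the integer interval `[i, j)`. -/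
noncomputable def countIco (A : Set ℤ) (i j : ℤ) : ℝ := ∑ k ∈ Finset.Ico i j, A.indicator 1 k

lemma countIco_nonneg (A : Set ℤ) (i j : ℤ) : 0 ≤ countIco A i j :=
  Finset.sum_nonneg fun _ _ => Set.indicator_nonneg (fun _ _ => zero_le_one) _

lemma countIco_add (A : Set ℤ) {i j k : ℤ} (hij : i ≤ j) (hjk : j ≤ k) :
    countIco A i j + countIco A j k = countIco A i k := by
  rw [countIco, countIco, countIco, ← Finset.Ico_union_Ico_eq_Ico hij hjk, Finset.sum_union]
  exact Finset.Ico_disjoint_Ico_consecutive i j k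

lemma countIco_mono (A : Set ℤ) {i j i' j' : ℤ} (hi : i' ≤ i) (hj : j ≤ j') :
    countIco A i j ≤ countIco A i' j' :=
  Finset.sum_le_sum_of_subset_of_nonneg (Finset.Ico_subset_Ico hi hj)
    fun _ _ _ => Set.indicator_nonneg (fun _ _ => zero_le_one) _

lemma countIco_le (A : Set ℤ) {i j : ℤ} (hij : i ≤ j) : countIco A i j ≤ j - i := by
  have : countIco A i j ≤ ∑ k ∈ Finset.Ico i j, (1 : ℝ) :=
    Finset.sum_le_sum fun k _ => Set.indicator_le_self' (fun _ _ => zero_le_one) k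
  refine this.trans (le_of_eq ?_)
  rw [Finset.sum_const, Int.card_Ico, nsmul_eq_mul, mul_one, ← Int.cast_natCast,
    Int.toNat_of_nonneg (by omega)]
  push_cast; ring

lemma countIco_diff {A G : Set ℤ} (hGA : G ⊆ A) (i j : ℤ) :
    countIco A i j = countIco G i j + countIco (A \ G) i j := by
  rw [countIco, countIco, countIco, ← Finset.sum_add_distrib]
  refine Finset.sum_congr rfl fun k _ => ?_
  by_cases hG : k ∈ G
  · simp [hG, hGA hG]
  · by_cases hA : k ∈ A <;> simp [hG, hA]

lemma countIco_eq_zero {A : Set ℤ} {i j : ℤ} (h : ∀ k, i ≤ k → k < j → k ∉ A) :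
    countIco A i j = 0 :=
  Finset.sum_eq_zero fun k hk => by
    rw [Finset.mem_Ico] at hk
    exact Set.indicator_of_notMem (h k hk.1 hk.2) _

/-- If the number of points of `A` in the intervals `(p - t, p + t)` around the points `p` of `G`
essentially depends on `t` only, and `G` fills most of `A` around `0`, then `A` has no gap on
one side of `0`. -/
theorem not_gap_of_homogeneous {A G : Set ℤ} (hGA : G ⊆ A) (h0 : (0 : ℤ) ∈ G) (a : ℕ → ℝ)
    {N : ℕ} (hN : 1 ≤ N) {K : ℝ} (hK : 0 ≤ K)
    (hlow : ∀ p ∈ G, ∀ t : ℕ, N ≤ t → a t ≤ countIco A (p - t + 1) (p + t))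
    (hupp : ∀ p ∈ G, ∀ t : ℕ, N ≤ t → countIco A (p - t + 1) (p + t) ≤ 9 / 8 * a t)
    (hdense : ∀ t : ℕ, 1 ≤ t →
      countIco (A \ G) (0 - t + 1) (0 + t) ≤ 1 / 100 * countIco A (0 - t + 1) (0 + t) + K)
    {n : ℕ} (hn : N ≤ n) (hgap : countIco A (-n + 1) 1 ≤ 1 / 100 * a n) :
    a n < 100 * (N + K + 1) := by
  by_contra! hlarge
  have hN' : (1 : ℝ) ≤ N := by exact_mod_cast hN
  set E := a n
  set F : ℤ → ℝ := fun t => countIco A 0 t with hF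
  have Fmono : ∀ {s t : ℤ}, s ≤ t → F s ≤ F t := fun h => countIco_mono A le_rfl h
  have Fupp : ∀ t : ℕ, N ≤ t → F t ≤ 9 / 8 * a t := fun t ht =>
    (countIco_mono A (by omega) (by omega)).trans (hupp 0 h0 t ht)
  -- By the gap, the negative half of the window about 0 costs at most E / 100.
  have Flow : ∀ t : ℕ, N ≤ t → t ≤ n → a t ≤ F t + 1 / 100 * E := by
    intro t ht htn
    have h1 := hlow 0 h0 t ht
    rw [← countIco_add A (j := 0) (by omega) (by omega), zero_add] at h1
    have h2 := countIco_mono A (i := 0 - t + 1) (j := 0) (i' := -n + 1) (j' := 1)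
      (by omega) (by omega)
    simp only [hF]
    linarith
  have hbad : countIco (A \ G) 0 n ≤ 9 / 800 * E + K := by
    have h1 := hdense n (by omega)
    have h2 := hupp 0 h0 n hn
    have h3 := countIco_mono (A \ G) (i := 0) (j := n) (i' := 0 - n + 1) (j' := 0 + n)
      (by omega) (by omega)
    linarith
  -- An interval of length at most `t` has at most `9 / 8 * a t` points of `G`.
  have hwin : ∀ (i j : ℤ) (t : ℕ), N ≤ t → j ≤ i + t → countIco G i j ≤ 9 / 8 * a t := by
    intro i j t ht hij
    by_cases hp : ∃ p ∈ G, i ≤ p ∧ p < j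
    · obtain ⟨p, hpG, hip, hpj⟩ := hp
      have h1 := countIco_diff hGA i j
      have h2 := countIco_nonneg (A \ G) i j
      have h3 := countIco_mono A (i := i) (j := j) (i' := p - t + 1) (j' := p + t)
        (by omega) (by omega)
      linarith [hupp p hpG t ht]
    · push Not at hp
      rw [countIco_eq_zero fun k hk hkj hkG => absurd hkj (not_lt.2 (hp k hkG hk))]
      exact (countIco_nonneg _ _ _).trans (hupp 0 h0 t ht)
  have hnE : 100 * (N : ℝ) ≤ E := by linarith
  have hFnE : F n ≥ 99 / 100 * E := by linarith [Flow n hn le_rfl]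
  have hFle : ∀ t : ℤ, 0 ≤ t → F t ≤ t := fun t ht => by
    simpa using countIco_le A ht
  have hNn : 10 * N ≤ n := by
    have h1 := hFle n (by omega)
    have : (10 * N : ℝ) ≤ n := by push_cast at h1; linarith
    exact_mod_cast this
  set q := n / 2 with hq
  -- Nearly all of the roughly E points in [0, n) lie in G, and each half holds at most 9/8 a(q + 1)
  -- of these; so a(q + 1) is not much below 4/9 E.
  have hFq : 42 / 100 * E - 45 / 100 * K ≤ F (q + 1) := by
    have h1 : countIco G 0 (q + 1 : ℕ) ≤ 9 / 8 * a (q + 1) := hwin _ _ _ (by omega) (by omega)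
    have h2 : countIco G (q + 1 : ℕ) n ≤ 9 / 8 * a (q + 1) := hwin _ _ _ (by omega) (by omega)
    have h3 := countIco_add G (i := 0) (j := (q + 1 : ℕ)) (k := n) (by omega) (by omega)
    have h4 := countIco_diff hGA 0 n
    have h5 := Flow (q + 1) (by omega) (by omega)
    have h6 : F n = countIco A 0 n := rfl
    push_cast at h5
    linarith
  -- `s` is the last point of `G` in `[0, n / 2]`.
  obtain ⟨s, hsG, hs0, hsq, hsmax⟩ : ∃ s : ℤ, s ∈ G ∧ 0 ≤ s ∧ s ≤ q ∧
      ∀ k, s < k → k ≤ q → k ∉ G := by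
    classical
    obtain ⟨s, hs⟩ := ((Finset.Icc (0 : ℤ) q).filter (· ∈ G)).exists_maximal
      ⟨0, by simp [h0]⟩
    have hs1 := hs.1
    simp only [Finset.mem_filter, Finset.mem_Icc] at hs1
    refine ⟨s, hs1.2, hs1.1.1, hs1.1.2, fun k hk hkq hkG => ?_⟩
    have := hs.2 (y := k) (by simp [hkG, hkq]; omega) hk.le
    omega
  have hFs : 37 / 100 * E ≤ F s := by
    have h1 := countIco_add A (i := 0) (j := s) (k := s + 1) (by omega) (by omega)
    have h2 := countIco_add A (i := 0) (j := s + 1) (k := q + 1) (by omega) (by omega)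
    have h3 := countIco_diff hGA (s + 1) (q + 1)
    rw [countIco_eq_zero (A := G) (fun k hk hkq => hsmax k (by omega) (by omega))] at h3
    have h4 := countIco_mono (A \ G) (i := s + 1) (j := q + 1) (i' := 0) (j' := n)
      (by omega) (by omega)
    have h5 := countIco_le A (i := s) (j := s + 1) (by omega)
    push_cast at h5
    simp only [hF] at hFq ⊢
    linarith
  lift s to ℕ using hs0
  have hsN : 2 * N ≤ s := by
    have h1 := hFle s (by omega)
    have : (2 * N : ℝ) ≤ s := by push_cast at h1; linarith
    exact_mod_cast this
  -- The window of radius p about p is [1, 2p); the summand 1 pays for the point 0.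
  have hdouble : ∀ p : ℕ, (p : ℤ) ∈ G → N ≤ p → p ≤ q →
      F (2 * p) ≤ 1 + 9 / 8 * (F p + 1 / 100 * E) := by
    intro p hpG hpN hpq
    have h1 := hupp p hpG p hpN
    have h2 := Flow p hpN (by omega)
    have h3 := countIco_add A (i := 0) (j := 1) (k := 2 * p) (by omega) (by omega)
    have h4 := countIco_le A (i := 0) (j := 1) (by omega)
    rw [show (p : ℤ) - p + 1 = 1 by ring, show (p : ℤ) + p = 2 * p by ring] at h1
    push_cast at h4
    simp only [hF] at h2 ⊢
    linarith
  set h := (s + 1) / 2 with hh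
  have hFs2 := hdouble s hsG (by omega) (by omega)
  -- The window of radius h about s is disjoint from [0, s - h + 1), which contains [0, h); its
  -- count is at least a h ≥ 8/9 F h.
  have hhalf : F h * (17 / 9) ≤ F (2 * s) := by
    have h1 := hlow s hsG h (by omega)
    have h2 := Fupp h (by omega)
    have h3 := countIco_add A (i := 0) (j := s - h + 1) (k := s + h) (by omega) (by omega)
    have h4 : F h ≤ F (s - h + 1) := Fmono (by omega)
    have h5 : F (s + h) ≤ F (2 * s) := Fmono (by omega)
    simp only [hF] at h2 h4 h5 ⊢
    linarith
  -- `p` is the first point of `G` in `[s / 2, s]`.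
  obtain ⟨p, hpG, hhp, hps, hpmin⟩ : ∃ p : ℤ, p ∈ G ∧ (h : ℤ) ≤ p ∧ p ≤ s ∧
      ∀ k, (h : ℤ) ≤ k → k < p → k ∉ G := by
    classical
    obtain ⟨p, hp⟩ := ((Finset.Icc (h : ℤ) s).filter (· ∈ G)).exists_minimal
      ⟨s, by simp [hsG]; omega⟩
    have hp1 := hp.1
    simp only [Finset.mem_filter, Finset.mem_Icc] at hp1
    refine ⟨p, hp1.2, hp1.1.1, hp1.1.2, fun k hk hkp hkG => ?_⟩
    have := hp.2 (y := k) (by simp [hkG, hk]; omega) hkp.le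
    omega
  lift p to ℕ using by omega
  have hFp := hdouble p hpG (by omega) (by omega)
  have hFsp : F s ≤ F (2 * p) := Fmono (by omega)
  have hFph : F p ≤ F h + (9 / 800 * E + K) := by
    have h2 := countIco_add A (i := 0) (j := h) (k := p) (by omega) (by omega)
    have h3 := countIco_diff hGA h p
    rw [countIco_eq_zero (A := G) (fun k hk hkq => hpmin k hk hkq)] at h3
    have h4 := countIco_mono (A \ G) (i := h) (j := p) (i' := 0) (j' := n)
      (by omega) (by omega)
    simp only [hF]
    linarith
  -- Doubling at s and at p bounds F(2s) by 81/64 F h plus errors, against 17/9 F h; since F s ≥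
  -- 37/100 E, the errors are too small to make up the difference.
  linarith

end Counting

/-! ### Maximal visit counts. -/

section Indicator

variable {X : Type*}

lemma birkhoffSum_mono_fun {T : X → X} {f g : X → ℝ} {n : ℕ} {x : X}
    (h : ∀ k < n, f (T^[k] x) ≤ g (T^[k] x)) : birkhoffSum T f n x ≤ birkhoffSum T g n x :=
  Finset.sum_le_sum fun k hk => h k (Finset.mem_range.1 hk)

lemma birkhoffSum_indicator_nonneg (T : X → X) (A : Set X) (n : ℕ) (x : X) :
    0 ≤ birkhoffSum T (A.indicator (1 : X → ℝ)) n x :=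
  Finset.sum_nonneg fun _ _ => Set.indicator_nonneg (fun _ _ => zero_le_one) _

/-- The largest number of visits to `G` during a time interval of length `n`. -/
noncomputable def maxVisits (T : X → X) (G : Set X) (n : ℕ) : ℝ :=
  ⨆ x, birkhoffSum T (G.indicator (1 : X → ℝ)) n x

lemma birkhoffSum_indicator_le (T : X → X) (G : Set X) (n : ℕ) (x : X) :
    birkhoffSum T (G.indicator (1 : X → ℝ)) n x ≤ n := by
  have : birkhoffSum T (G.indicator (1 : X → ℝ)) n x ≤ ∑ k ∈ Finset.range n, (1 : ℝ) :=
    Finset.sum_le_sum fun k _ => Set.indicator_le_self' (fun _ _ => zero_le_one) _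
  simpa using this

lemma birkhoffSum_le_maxVisits (T : X → X) (G : Set X) (n : ℕ) (x : X) :
    birkhoffSum T (G.indicator 1) n x ≤ maxVisits T G n :=
  le_ciSup (f := fun x => birkhoffSum T (G.indicator (1 : X → ℝ)) n x)
    ⟨n, by rintro _ ⟨y, rfl⟩; exact birkhoffSum_indicator_le T G n y⟩ x

lemma maxVisits_add_le [Nonempty X] (T : X → X) (G : Set X) (m n : ℕ) :
    maxVisits T G (m + n) ≤ maxVisits T G m + maxVisits T G n :=
  ciSup_le fun x => by
    rw [birkhoffSum_add]
    exact add_le_add (birkhoffSum_le_maxVisits _ _ _ _) (birkhoffSum_le_maxVisits _ _ _ _)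

lemma monotone_maxVisits [Nonempty X] (T : X → X) (G : Set X) : Monotone (maxVisits T G) :=
  fun m n hmn => ciSup_le fun x => by
    refine le_trans ?_ (birkhoffSum_le_maxVisits T G n x)
    exact Finset.sum_le_sum_of_subset_of_nonneg (Finset.range_mono hmn)
      fun _ _ _ => Set.indicator_nonneg (fun _ _ => zero_le_one) _

end Indicator

/-! ### Recurrence, long excursions and one-sided gaps. -/

section Gap

variable {X : Type*} [MeasurableSpace X] {μ : Measure X}

lemma MeasureTheory.Conservative.measurableEquiv_symm {T : X ≃ᵐ X} (hc : Conservative T μ)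
    (hT : MeasurePreserving T μ μ) : Conservative T.symm μ := by
  refine ⟨(MeasurePreserving.symm T hT).quasiMeasurePreserving, fun s hs h0 => ?_⟩
  obtain ⟨x, hx, m, hm, hxm⟩ := hc.exists_mem_iterate_mem' hs h0
  refine ⟨_, hxm, m, hm, ?_⟩
  have : Function.LeftInverse T.symm T := T.symm_apply_apply
  rwa [this.iterate m x]

/-- The set of points visiting G infinitely often is invariant and, by Poincaré recurrence, contains
almost all of G. -/
theorem Ergodic.ae_frequently_mem_of_conservative {T : X → X} (he : Ergodic T μ)
    (hc : Conservative T μ) {G : Set X} (hG : MeasurableSet G) (h0 : μ G ≠ 0) :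
    ∀ᵐ x ∂μ, ∃ᶠ n in atTop, T^[n] x ∈ G := by
  set V : Set X := {x | ∃ᶠ n in atTop, T^[n] x ∈ G}
  have hV : MeasurableSet V := by
    have : V = ⋂ N : ℕ, ⋃ n : ℕ, ⋃ _ : N ≤ n, T^[n] ⁻¹' G := by
      ext; simp [V, frequently_atTop]
    rw [this]
    exact .iInter fun N => .iUnion fun n => .iUnion fun _ => he.measurable.iterate n hG
  have hVi : T ⁻¹' V = V := by
    ext x
    change (∃ᶠ n in atTop, T^[n + 1] x ∈ G) ↔ ∃ᶠ n in atTop, T^[n] x ∈ G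
    conv_rhs => rw [← map_add_atTop_eq_nat 1, frequently_map]
  rcases he.toPreErgodic.ae_mem_or_ae_notMem hV hVi with h | h
  · exact h
  · exfalso
    refine h0 (measure_eq_zero_iff_ae_notMem.2 ?_)
    filter_upwards [h, hc.ae_mem_imp_frequently_image_mem hG.nullMeasurableSet] with x hx hx' hxG
    exact hx (hx' hxG)

/-- The points of `A` which do not lie on an orbit segment of length at most `M` between two
visits to `G`. -/
def longExcursion (T : X ≃ᵐ X) (A G : Set X) (M : ℕ) : Set X :=
  {y | y ∈ A ∧ ∀ i j : ℕ, i + j ≤ M → 0 < j → T.symm^[i] y ∈ G → T^[j] y ∉ G}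

lemma measurableSet_longExcursion (T : X ≃ᵐ X) {A G : Set X} (hA : MeasurableSet A)
    (hG : MeasurableSet G) (M : ℕ) : MeasurableSet (longExcursion T A G M) := by
  have : longExcursion T A G M = A ∩ ⋂ i : ℕ, ⋂ j : ℕ, ⋂ _ : i + j ≤ M, ⋂ _ : 0 < j,
      (T.symm^[i] ⁻¹' G ∩ T^[j] ⁻¹' G)ᶜ := by
    ext; simp [longExcursion]
  rw [this]
  exact hA.inter <| .iInter fun i => .iInter fun j => .iInter fun _ => .iInter fun _ =>
    ((T.symm.measurable.iterate i hG).inter (T.measurable.iterate j hG)).compl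

/-- By recurrence under T and its inverse, almost every point lies between two visits to G, so the
decreasing sets have null intersection. -/
lemma tendsto_measure_longExcursion {T : X ≃ᵐ X} (he : Ergodic T μ) (hc : Conservative T μ)
    {A G : Set X} (hA : MeasurableSet A) (hG : MeasurableSet G) (hAf : μ A ≠ ⊤) (h0 : μ G ≠ 0) :
    Tendsto (fun M => μ (longExcursion T A G M)) atTop (𝓝 0) := by
  have hanti : Antitone (longExcursion T A G) := fun M M' h y hy =>
    ⟨hy.1, fun i j hij => hy.2 i j (hij.trans h)⟩
  have := tendsto_measure_iInter_atTop (μ := μ)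
    (fun M => (measurableSet_longExcursion T hA hG M).nullMeasurableSet) hanti
    ⟨0, ne_top_of_le_ne_top hAf (measure_mono fun y hy => hy.1)⟩
  convert! this
  symm
  refine measure_eq_zero_iff_ae_notMem.2 ?_
  filter_upwards [he.ae_frequently_mem_of_conservative hc hG h0,
    he.symm.ae_frequently_mem_of_conservative (hc.measurableEquiv_symm he.toMeasurePreserving)
      hG h0] with x hx hx' hmem
  obtain ⟨i, hi⟩ := hx'.exists
  obtain ⟨j, hj, hjG⟩ := (frequently_atTop.1 hx) 1
  exact (Set.mem_iInter.1 hmem (i + j)).2 i j le_rfl hj hi hjG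

/-- Cut the orbit at its visits to G. An excursion of length at most M is charged to the argument of
b, at cost M per visit. A longer one is split off by subadditivity and paid for by `hb`, since all
its visits to A lie in `longExcursion`. The induction accumulates short lengths in m; the
alternative n = 0 allows a truncated last excursion. -/
lemma subadditive_le_of_long_excursions (T : X ≃ᵐ X) {A G : Set X} {b : ℕ → ℝ}
    (hmono : Monotone b) (hsub : ∀ m n, b (m + n) ≤ b m + b n) {C : ℝ} (hC : 0 ≤ C) {M : ℕ}
    (hb : ∀ e ∈ G, ∀ n ≥ M, b n ≤ C * birkhoffSum T (A.indicator 1) n e) (n : ℕ) :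
    ∀ (m : ℕ) (x : X), (x ∈ G ∨ n = 0) → ∃ k : ℕ, (k : ℝ) ≤ birkhoffSum T (G.indicator 1) n x ∧
      b (m + n) ≤ b (m + M * k) +
        C * birkhoffSum T ((longExcursion T A G M).indicator 1) n x := by
  induction n using Nat.strong_induction_on with
  | _ n ih =>
  intro m x hx
  rcases Nat.eq_zero_or_pos n with rfl | hn
  · exact ⟨0, by simp, by simp⟩
  have hxG : x ∈ G := hx.resolve_right hn.ne'
  obtain ⟨r, hr0, hrn, hrG, hrmin⟩ : ∃ r, 0 < r ∧ r ≤ n ∧ (T^[r] x ∈ G ∨ n - r = 0) ∧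
      ∀ k, 0 < k → k < r → T^[k] x ∉ G := by
    classical
    by_cases hex : ∃ r, 0 < r ∧ r < n ∧ T^[r] x ∈ G
    · refine ⟨Nat.find hex, (Nat.find_spec hex).1, (Nat.find_spec hex).2.1.le,
        .inl (Nat.find_spec hex).2.2, fun k hk hkr hkG => Nat.find_min hex hkr ⟨hk, ?_, hkG⟩⟩
      exact hkr.trans (Nat.find_spec hex).2.1
    · push Not at hex
      exact ⟨n, hn, le_rfl, .inr (Nat.sub_self n), fun k hk hkn => hex k hk hkn⟩
  set D := longExcursion T A G M
  have hsplit : ∀ B : Set X, birkhoffSum T (B.indicator (1 : X → ℝ)) n x =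
      birkhoffSum T (B.indicator 1) r x + birkhoffSum T (B.indicator 1) (n - r) (T^[r] x) :=
    fun B => by rw [← birkhoffSum_add, Nat.add_sub_cancel' hrn]
  have hone : 1 ≤ birkhoffSum T (G.indicator (1 : X → ℝ)) r x := by
    obtain ⟨r', rfl⟩ := Nat.exists_eq_succ_of_ne_zero hr0.ne'
    rw [birkhoffSum_succ', Set.indicator_of_mem hxG]
    simpa using birkhoffSum_indicator_nonneg T G r' (T x)
  have hDr := birkhoffSum_indicator_nonneg T D r x
  by_cases hrM : r ≤ M
  · obtain ⟨k, hk, hbk⟩ := ih (n - r) (by omega) (m + r) (T^[r] x) hrG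
    refine ⟨k + 1, by rw [hsplit]; push_cast; linarith, ?_⟩
    have h1 : b (m + r + M * k) ≤ b (m + M * (k + 1)) := hmono (by rw [mul_add]; omega)
    rw [show m + r + (n - r) = m + n by omega] at hbk
    rw [hsplit, mul_add C]
    have := mul_nonneg hC hDr
    linarith
  · obtain ⟨k, hk, hbk⟩ := ih (n - r) (by omega) m (T^[r] x) hrG
    refine ⟨k, by rw [hsplit]; linarith, ?_⟩
    have h1 : b (m + n) ≤ b r + b (m + (n - r)) := by
      rw [show m + n = r + (m + (n - r)) by omega]; exact hsub _ _
    have h2 := hb x hxG r (by omega)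
    have h3 : birkhoffSum T (A.indicator (1 : X → ℝ)) r x ≤ birkhoffSum T (D.indicator 1) r x := by
      refine birkhoffSum_mono_fun fun l hl => ?_
      by_cases hlA : T^[l] x ∈ A
      · have hlD : T^[l] x ∈ D := by
          refine ⟨hlA, fun i j hij hj hi hjG => ?_⟩
          have hinv : Function.LeftInverse T.symm T := T.symm_apply_apply
          rw [← Function.iterate_add_apply] at hjG
          have h5 : ¬ (j + l < r) := fun h => hrmin _ (by omega) h hjG
          have h6 : i < l := by omega
          refine hrmin (l - i) (by omega) (by omega) ?_
          have : T^[l] x = T^[i] (T^[l - i] x) := by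
            rw [← Function.iterate_add_apply, Nat.add_sub_cancel' h6.le]
          rwa [this, hinv.iterate i] at hi
        rw [Set.indicator_of_mem hlA, Set.indicator_of_mem hlD]
      · rw [Set.indicator_of_notMem hlA]
        exact Set.indicator_nonneg (fun _ _ => zero_le_one) _
    have h4 := mul_le_mul_of_nonneg_left h3 hC
    rw [hsplit, mul_add]
    linarith

/-- If `b` is subadditive, sublinear, and bounds the number of visits to `G` during a time
interval of given length, then the orbits of some points of `G` visit `A` rarely with respect to
`b` for a long time. -/
theorem exists_birkhoffSum_indicator_le {T : X ≃ᵐ X} (he : Ergodic T μ) (hc : Conservative T μ)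
    {A G : Set X} (hA : MeasurableSet A) (hG : MeasurableSet G) (hGA : G ⊆ A) (hAf : μ A ≠ ⊤)
    (h0 : μ G ≠ 0) {b : ℕ → ℝ} (hmono : Monotone b) (hsub : ∀ m n, b (m + n) ≤ b m + b n)
    (hlin : ∀ ε > 0, ∃ K, ∀ n : ℕ, b n ≤ ε * n + K)
    (hvis : ∀ n x, birkhoffSum T (G.indicator 1) n x ≤ b n) {η : ℝ} (hη : 0 < η) (M : ℕ) :
    ∃ e ∈ G, ∃ n ≥ M, birkhoffSum T (A.indicator 1) n e ≤ η * b n := by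
  by_contra! hcon
  have hGf : μ G ≠ ⊤ := ne_top_of_le_ne_top hAf (measure_mono hGA)
  have hGr : 0 < μ.real G := ENNReal.toReal_pos h0 hGf
  -- The factor 4 makes the long excursions cost at most a quarter of the visits to G; the slope 1 /
  -- (4 * L) chosen below does the same for the short ones. Together they bound the visits to G by
  -- half of themselves plus a constant, contrary to recurrence.
  have hlim : Tendsto (fun M => 4 * η⁻¹ * μ.real (longExcursion T A G M)) atTop (𝓝 0) := by
    have := (ENNReal.tendsto_toReal ENNReal.zero_ne_top).comp
      (tendsto_measure_longExcursion he hc hA hG hAf h0)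
    simpa [Measure.real] using this.const_mul (4 * η⁻¹)
  obtain ⟨L, hLM, hL1, hL⟩ := ((eventually_ge_atTop M).and <| (eventually_ge_atTop 1).and
    (hlim.eventually (gt_mem_nhds hGr))).exists
  set D := longExcursion T A G L
  have hD : MeasurableSet D := measurableSet_longExcursion T hA hG L
  have hDf : μ D ≠ ⊤ := ne_top_of_le_ne_top hAf (measure_mono fun y hy => hy.1)
  have hratio := he.ae_exists_birkhoffSum_le_add (f := D.indicator 1) (g := G.indicator 1)
    (c := 4 * η⁻¹) (d := 1) (measurable_one.indicator hD) (measurable_one.indicator hG)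
    ((integrable_indicator_iff hD).2 (integrableOn_const hDf))
    ((integrable_indicator_iff hG).2 (integrableOn_const hGf))
    (by rw [integral_indicator_one hD, integral_indicator_one hG, one_mul]; exact hL)
  obtain ⟨x, hxG, hfreq, K, hK⟩ := ((frequently_ae_mem_iff.2 h0).and_eventually
    ((he.ae_frequently_mem_of_conservative hc hG h0).and hratio)).exists
  obtain ⟨K', hK'⟩ := hlin (1 / (4 * L)) (by positivity)
  have hbound : ∀ n, birkhoffSum T (G.indicator (1 : X → ℝ)) n x ≤ 2 * K' + K / 2 := by
    intro n
    have hb : ∀ e ∈ G, ∀ n ≥ L, b n ≤ η⁻¹ * birkhoffSum T (A.indicator 1) n e := by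
      intro e heG n hn
      rw [inv_mul_eq_div, le_div_iff₀ hη, mul_comm]
      exact (hcon e heG n (hLM.trans hn)).le
    obtain ⟨k, hk, hbk⟩ := subadditive_le_of_long_excursions T hmono hsub (inv_nonneg.2 hη.le)
      hb n 0 x (.inl hxG)
    have h1 := hvis n x
    have h2 := hK' (L * k)
    have h3 := hK n
    have h4 : 1 / (4 * L) * ((L * k : ℕ) : ℝ) = k / 4 := by
      have : (L : ℝ) ≠ 0 := by positivity
      push_cast; field_simp
    rw [zero_add, zero_add] at hbk
    linarith
  have hunb : ∀ m : ℕ, ∃ n, (m : ℝ) ≤ birkhoffSum T (G.indicator (1 : X → ℝ)) n x := by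
    intro m
    induction m with
    | zero => exact ⟨0, by simp⟩
    | succ m ih =>
      obtain ⟨n, hn⟩ := ih
      obtain ⟨n', hn', hn'G⟩ := frequently_atTop.1 hfreq n
      refine ⟨n' + 1, ?_⟩
      rw [birkhoffSum_succ, Set.indicator_of_mem hn'G]
      have : birkhoffSum T (G.indicator (1 : X → ℝ)) n x ≤
          birkhoffSum T (G.indicator 1) n' x :=
        Finset.sum_le_sum_of_subset_of_nonneg (Finset.range_mono hn')
          fun _ _ _ => Set.indicator_nonneg (fun _ _ => zero_le_one) _
      push_cast
      simp only [Pi.one_apply]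
      linarith
  obtain ⟨m, hm⟩ := exists_nat_gt (2 * K' + K / 2)
  obtain ⟨n, hn⟩ := hunb m
  linarith [hbound n]

end Gap

/-! ### Sublinearity of visits, the indicator case and the reduction to it. -/

section Main

variable {X : Type*} [MeasurableSpace X]

lemma symmBirkhoffSum_indicator_nonneg (T : X ≃ᵐ X) (A : Set X) (n : ℕ) (x : X) :
    0 ≤ symmBirkhoffSum T (A.indicator 1) n x :=
  Finset.sum_nonneg fun _ _ => Set.indicator_nonneg (fun _ _ => zero_le_one) _

lemma symmBirkhoffSum_indicator_le (T : X ≃ᵐ X) (A : Set X) (n : ℕ) (x : X) :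
    symmBirkhoffSum T (A.indicator 1) n x ≤ 2 * n := by
  have : symmBirkhoffSum T (A.indicator 1) n x ≤ ∑ k ∈ Finset.Ioo (-(n : ℤ)) n, (1 : ℝ) :=
    Finset.sum_le_sum fun k _ => Set.indicator_le_self' (fun _ _ => zero_le_one) _
  refine this.trans ?_
  rw [Finset.sum_const, Int.card_Ioo, nsmul_eq_mul, mul_one]
  have : ((n : ℤ) - -(n : ℤ) - 1).toNat ≤ 2 * n := by omega
  exact_mod_cast this

lemma symmBirkhoffSum_indicator_orbitPoint (T : X ≃ᵐ X) (A : Set X) (n : ℕ) (p : ℤ) (x : X) :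
    symmBirkhoffSum T (A.indicator 1) n (orbitPoint T p x) =
      countIco {k | orbitPoint T k x ∈ A} (p - n + 1) (p + n) := by
  rw [symmBirkhoffSum_eq_sum_orbitPoint, countIco]
  refine Finset.sum_nbij' (fun k => k + p) (fun k => k - p) ?_ ?_ ?_ ?_ ?_
  · intro k hk; simp only [Finset.mem_Ioo, Finset.mem_Ico] at hk ⊢; omega
  · intro k hk; simp only [Finset.mem_Ioo, Finset.mem_Ico] at hk ⊢; omega
  · intro k _; ring
  · intro k _; ring
  · intro k _
    rw [← orbitPoint_add]
    rfl

lemma birkhoffSum_symm_indicator (T : X ≃ᵐ X) (A : Set X) (n : ℕ) (x : X) :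
    birkhoffSum T.symm (A.indicator (1 : X → ℝ)) n x =
      countIco {k | orbitPoint T k x ∈ A} (-n + 1) 1 := by
  rw [birkhoffSum, countIco]
  refine Finset.sum_nbij' (fun k => -(k : ℤ)) (fun k => (-k).toNat) ?_ ?_ ?_ ?_ ?_
  · intro k hk; simp only [Finset.mem_range, Finset.mem_Ico] at hk ⊢; omega
  · intro k hk; simp only [Finset.mem_range, Finset.mem_Ico] at hk ⊢; omega
  · intro k _; simp
  · intro k hk; simp only [Finset.mem_Ico] at hk ⊢; omega
  · intro k _
    rw [← orbitPoint_neg_natCast]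
    rfl

/-- A time interval of length n containing a visit p to G lies inside the window of radius n about
p. -/
lemma maxVisits_symm_le [Nonempty X] (T : X ≃ᵐ X) {A G : Set X} (hGA : G ⊆ A) {n : ℕ} {c : ℝ}
    (hc : 0 ≤ c) (h : ∀ x ∈ G, symmBirkhoffSum T (A.indicator 1) n x ≤ c) :
    maxVisits T.symm G n ≤ c := by
  refine ciSup_le fun x => ?_
  rw [birkhoffSum_symm_indicator]
  by_cases hp : ∃ p : ℤ, -n + 1 ≤ p ∧ p < 1 ∧ orbitPoint T p x ∈ G
  · obtain ⟨p, hp1, hp2, hpG⟩ := hp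
    refine le_trans ?_ (h _ hpG)
    rw [symmBirkhoffSum_indicator_orbitPoint]
    have h1 := countIco_mono {k | orbitPoint T k x ∈ G} (i := -n + 1) (j := 1)
      (i' := p - n + 1) (j' := p + n) (by omega) (by omega)
    have h2 := countIco_diff (A := {k | orbitPoint T k x ∈ A}) (G := {k | orbitPoint T k x ∈ G})
      (fun k hk => hGA hk) (p - n + 1) (p + n)
    have h3 := countIco_nonneg ({k | orbitPoint T k x ∈ A} \ {k | orbitPoint T k x ∈ G})
      (p - n + 1) (p + n)
    linarith
  · push Not at hp
    rw [countIco_eq_zero (A := {k | orbitPoint T k x ∈ G}) hp]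
    exact hc

variable {μ : Measure X} [SigmaFinite μ]

/-- In an infinite measure space, visits to a set of finite measure have zero density. -/
lemma Ergodic.ae_exists_symmBirkhoffSum_indicator_le_mul {T : X ≃ᵐ X} (he : Ergodic T μ)
    (hμ : μ Set.univ = ⊤) {A : Set X} (hA : MeasurableSet A) (hAf : μ A ≠ ⊤) {ε : ℝ}
    (hε : 0 < ε) :
    ∀ᵐ x ∂μ, ∃ K : ℝ, ∀ n : ℕ, symmBirkhoffSum T (A.indicator 1) n x ≤ ε * n + K := by
  -- Compare A with a much larger set of finite measure, whose visit count is trivially at most 2n.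
  obtain ⟨Y, hY, -, hYA, hYf⟩ := Measure.exists_subset_measure_lt_top (μ := μ)
    MeasurableSet.univ (r := ENNReal.ofReal (2 / ε * μ.real A)) (by rw [hμ]; simp)
  have hlt : 1 * ∫ x, A.indicator (1 : X → ℝ) x ∂μ < ε / 2 * ∫ x, Y.indicator (1 : X → ℝ) x ∂μ := by
    rw [integral_indicator_one hA, integral_indicator_one hY]
    have := (ENNReal.ofReal_lt_iff_lt_toReal (by positivity) hYf.ne).1 hYA
    change _ < μ.real Y at this
    rw [div_mul_eq_mul_div, div_lt_iff₀ hε] at this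
    linarith
  filter_upwards [he.ae_exists_symmBirkhoffSum_le_add (measurable_one.indicator hA)
    (measurable_one.indicator hY) ((integrable_indicator_iff hA).2 (integrableOn_const hAf))
    ((integrable_indicator_iff hY).2 (integrableOn_const hYf.ne)) hlt] with x ⟨K, hK⟩
  refine ⟨K, fun n => ?_⟩
  have h1 := hK n
  have h2 := symmBirkhoffSum_indicator_le T Y n x
  nlinarith

/-- The case of an indicator function: the symmetric Birkhoff sums cannot be asymptotic, up to
a factor `9 / 8`, to a fixed sequence at almost every point of the set. -/
theorem not_ae_symmBirkhoffSum_indicator_bounds {T : X ≃ᵐ X} (hcons : Conservative T μ)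
    (he : Ergodic T μ) (hμ : μ Set.univ = ⊤) {a : ℕ → ℝ} (ha : Tendsto a atTop atTop) {A : Set X}
    (hA : MeasurableSet A) (hAf : μ A ≠ ⊤) (hA0 : μ A ≠ 0)
    (h : ∀ᵐ x ∂μ, x ∈ A → ∀ᶠ n in atTop, a n ≤ symmBirkhoffSum T (A.indicator 1) n x ∧
      symmBirkhoffSum T (A.indicator 1) n x ≤ 9 / 8 * a n) : False := by
  have hAm : Measurable (A.indicator (1 : X → ℝ)) := measurable_one.indicator hA
  have hAi : ∀ {B : Set X}, MeasurableSet B → B ⊆ A → Integrable (B.indicator (1 : X → ℝ)) μ :=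
    fun hB hBA => (integrable_indicator_iff hB).2
      (integrableOn_const (ne_top_of_le_ne_top hAf (measure_mono hBA)))
  have hAr : 0 < μ.real A := ENNReal.toReal_pos hA0 hAf
  -- `G` is a large subset of `A` on which the bounds are uniform.
  let W : ℕ → Set X := fun N => A ∩ ⋂ n : ℕ, ⋂ _ : N ≤ n,
    ({x | a n ≤ symmBirkhoffSum T (A.indicator 1) n x} ∩
      {x | symmBirkhoffSum T (A.indicator 1) n x ≤ 9 / 8 * a n})
  have hWm : ∀ N, MeasurableSet (W N) := fun N => hA.inter <| .iInter fun n => .iInter fun _ =>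
    (measurableSet_le measurable_const (measurable_symmBirkhoffSum T hAm n)).inter
      (measurableSet_le (measurable_symmBirkhoffSum T hAm n) measurable_const)
  have hWmem : ∀ {N x}, x ∈ W N ↔ x ∈ A ∧ ∀ n ≥ N, a n ≤ symmBirkhoffSum T (A.indicator 1) n x ∧
      symmBirkhoffSum T (A.indicator 1) n x ≤ 9 / 8 * a n := by
    intro N x; simp [W]
  have hWlim : Tendsto (fun N => μ (A \ W N)) atTop (𝓝 0) := by
    have hanti : Antitone fun N => A \ W N := fun N N' hN x hx =>
      ⟨hx.1, fun hxN => hx.2 (hWmem.2 ⟨hx.1, fun n hn => (hWmem.1 hxN).2 n (hN.trans hn)⟩)⟩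
    have := tendsto_measure_iInter_atTop (μ := μ)
      (fun N => (hA.diff (hWm N)).nullMeasurableSet) hanti
      ⟨0, ne_top_of_le_ne_top hAf (measure_mono Set.sdiff_subset)⟩
    convert! this
    symm
    refine measure_eq_zero_iff_ae_notMem.2 ?_
    filter_upwards [h] with x hx hmem
    have hxA := (Set.mem_iInter.1 hmem 0).1
    obtain ⟨N, hN⟩ := eventually_atTop.1 (hx hxA)
    exact (Set.mem_iInter.1 hmem N).2 (hWmem.2 ⟨hxA, hN⟩)
  have hWlim' : Tendsto (fun N => 1 * μ.real (A \ W N)) atTop (𝓝 0) := by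
    have := (ENNReal.tendsto_toReal ENNReal.zero_ne_top).comp hWlim
    simpa [Measure.real, Function.comp_def] using this
  obtain ⟨N, hN1, hN⟩ := ((eventually_ge_atTop 1).and
    (hWlim'.eventually (gt_mem_nhds (show 0 < 1 / 100 * μ.real A by positivity)))).exists
  set G := W N
  have hG : MeasurableSet G := hWm N
  have hGA : G ⊆ A := Set.inter_subset_left
  have hG0 : μ G ≠ 0 := by
    intro h0
    rw [measureReal_def, measure_sdiff_null' (measure_mono_null Set.inter_subset_right h0),
      ← measureReal_def] at hN
    linarith
  -- `V K` is a set of points around which `G` is dense in `A`.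
  let V : ℕ → Set X := fun K => G ∩ ⋂ n : ℕ, {x | symmBirkhoffSum T ((A \ G).indicator 1) n x ≤
    1 / 100 * symmBirkhoffSum T (A.indicator 1) n x + K}
  have hVm : ∀ K, MeasurableSet (V K) := fun K => hG.inter <| .iInter fun n =>
    measurableSet_le (measurable_symmBirkhoffSum T (measurable_one.indicator (hA.diff hG)) n)
      (((measurable_symmBirkhoffSum T hAm n).const_mul _).add_const _)
  -- As A \ G has less than 1/100 of the measure of A, the ratio comparison shows that the sets V K
  -- cover almost all of G.
  obtain ⟨K, hV0⟩ : ∃ K, μ (V K) ≠ 0 := by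
    by_contra! hnull
    have hdense := he.ae_exists_symmBirkhoffSum_le_add (c := 1) (d := 1 / 100)
      (measurable_one.indicator (hA.diff hG)) hAm (hAi (hA.diff hG) Set.sdiff_subset)
      (hAi hA le_rfl)
      (by rw [integral_indicator_one (hA.diff hG), integral_indicator_one hA]; exact hN)
    refine hG0 (measure_eq_zero_iff_ae_notMem.2 ?_)
    filter_upwards [hdense, measure_eq_zero_iff_ae_notMem.1 (measure_iUnion_null hnull)]
      with x ⟨K', hK'⟩ hx hxG
    obtain ⟨K, hK⟩ := exists_nat_ge K'
    refine hx (Set.mem_iUnion.2 ⟨K, hxG, Set.mem_iInter.2 fun n => ?_⟩)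
    have := hK' n
    simp only [Set.mem_ofPred_eq]
    linarith
  have hVG : V K ⊆ G := Set.inter_subset_left
  obtain ⟨e₀, he₀⟩ := nonempty_of_measure_ne_zero hV0
  have : Nonempty X := ⟨e₀⟩
  have ha0 : ∀ n ≥ N, 0 ≤ 9 / 8 * a n := fun n hn =>
    (symmBirkhoffSum_indicator_nonneg T A n e₀).trans ((hWmem.1 (hVG he₀)).2 n hn).2
  -- The maximal visit count stands in for a, which need be neither monotone nor subadditive.
  have hvis : ∀ n ≥ N, maxVisits T.symm (V K) n ≤ 9 / 8 * a n := fun n hn =>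
    maxVisits_symm_le T (hVG.trans hGA) (ha0 n hn) fun x hx => ((hWmem.1 (hVG hx)).2 n hn).2
  have hlin : ∀ ε > 0, ∃ K' : ℝ, ∀ n : ℕ, maxVisits T.symm (V K) n ≤ ε * n + K' := by
    intro ε hε
    obtain ⟨x, hx, K', hK'⟩ := ((frequently_ae_mem_iff.2 hV0).and_eventually
      (he.ae_exists_symmBirkhoffSum_indicator_le_mul hμ hA hAf
        (show 0 < 8 / 9 * ε by positivity))).exists
    refine ⟨9 / 8 * |K'| + N, fun n => ?_⟩
    have hεn : 0 ≤ ε * n := by positivity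
    have hK0 := abs_nonneg K'
    rcases le_total N n with hn | hn
    · have h1 := hvis n hn
      have h2 := ((hWmem.1 (hVG hx)).2 n hn).1
      have h3 := hK' n
      have h4 := le_abs_self K'
      have h5 : (0 : ℝ) ≤ N := by positivity
      linarith
    · have h1 : maxVisits T.symm (V K) n ≤ n := ciSup_le fun x => birkhoffSum_indicator_le _ _ n x
      have h2 : (n : ℝ) ≤ N := by exact_mod_cast hn
      linarith
  -- Beyond M, a n exceeds the bound that a gap would force. Below, η = 8/900 turns `hvis` into a
  -- gap of size a n / 100; using the inverse map puts it in the past.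
  obtain ⟨M, hM⟩ := eventually_atTop.1 (ha.eventually_ge_atTop (100 * (N + K + 1 : ℝ)))
  obtain ⟨e, heV, n, hn, hgap⟩ := exists_birkhoffSum_indicator_le he.symm
    (hcons.measurableEquiv_symm he.toMeasurePreserving) hA (hVm K) (hVG.trans hGA) hAf hV0
    (monotone_maxVisits _ _) (maxVisits_add_le _ _) hlin (birkhoffSum_le_maxVisits _ _)
    (show (0 : ℝ) < 8 / 900 by norm_num) (max N M)
  have hnN : N ≤ n := (le_max_left _ _).trans hn
  refine absurd (hM n ((le_max_right _ _).trans hn)) (not_le.2 ?_)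
  refine not_gap_of_homogeneous (A := {k | orbitPoint T k e ∈ A})
    (G := {k | orbitPoint T k e ∈ G}) (fun k hk => hGA hk) (by simpa using hVG heV) a hN1
    K.cast_nonneg ?_ ?_ ?_ hnN ?_
  · intro p hp t ht
    rw [← symmBirkhoffSum_indicator_orbitPoint]
    exact ((hWmem.1 hp).2 t ht).1
  · intro p hp t ht
    rw [← symmBirkhoffSum_indicator_orbitPoint]
    exact ((hWmem.1 hp).2 t ht).2
  · intro t _
    have h1 := Set.mem_iInter.1 heV.2 t
    have h2 := symmBirkhoffSum_indicator_orbitPoint T A t 0 e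
    have h3 := symmBirkhoffSum_indicator_orbitPoint T (A \ G) t 0 e
    rw [orbitPoint_zero] at h2 h3
    rw [← h2]
    exact h3.symm.le.trans h1
  · rw [← birkhoffSum_symm_indicator]
    have := hvis n hnN
    linarith

/-- The symmetric Birkhoff sums of a nonnegative integrable function are almost nowhere
asymptotic, up to a factor `101 / 100`, to a fixed sequence. -/
theorem ae_not_eventually_symmBirkhoffSum_bounds {T : X ≃ᵐ X} (hcons : Conservative T μ)
    (he : Ergodic T μ) (hμ : μ Set.univ = ⊤) {a : ℕ → ℝ} (ha : Tendsto a atTop atTop)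
    {f : X → ℝ} (hfm : Measurable f) (hf : Integrable f μ) (hf0 : 0 ≤ᵐ[μ] f) {L U : ℝ}
    (hL : 0 < L) (hU : U ≤ 101 / 100 * L) :
    ∀ᵐ x ∂μ, ¬ ∀ᶠ n in atTop, L * a n ≤ symmBirkhoffSum T f n x ∧
      symmBirkhoffSum T f n x ≤ U * a n := by
  set P : Set X := {x | ∀ᶠ n in atTop, L * a n ≤ symmBirkhoffSum T f n x ∧
      symmBirkhoffSum T f n x ≤ U * a n}
  have hP : MeasurableSet P := by
    have : P = ⋃ N : ℕ, ⋂ n : ℕ, ⋂ _ : N ≤ n, ({x | L * a n ≤ symmBirkhoffSum T f n x} ∩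
        {x | symmBirkhoffSum T f n x ≤ U * a n}) := by
      ext; simp [P, eventually_atTop]
    rw [this]
    exact .iUnion fun N => .iInter fun n => .iInter fun _ =>
      (measurableSet_le measurable_const (measurable_symmBirkhoffSum T hfm n)).inter
        (measurableSet_le (measurable_symmBirkhoffSum T hfm n) measurable_const)
  change ∀ᵐ x ∂μ, x ∉ P
  rw [← measure_eq_zero_iff_ae_notMem]
  by_contra hP0
  obtain ⟨A, hA, hAP, hA0, hAf⟩ :=
    Measure.exists_subset_measure_lt_top hP (pos_iff_ne_zero.2 hP0)
  have hI : 0 < ∫ x, f x ∂μ := by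
    refine lt_of_le_of_ne (integral_nonneg_of_ae hf0) fun hI => ?_
    have hfz := (integral_eq_zero_iff_of_nonneg_ae hf0 hf).1 hI.symm
    obtain ⟨x, hxA, hx⟩ := ((frequently_ae_mem_iff.2 hA0.ne').and_eventually
      (symmBirkhoffSum_congr_ae he.toMeasurePreserving hfz)).exists
    obtain ⟨n, hn, hn'⟩ := ((hAP hxA).and (ha.eventually_gt_atTop 0)).exists
    have h1 : symmBirkhoffSum T f n x = 0 := by rw [hx n]; simp [symmBirkhoffSum]
    have := mul_pos hL hn'
    linarith [hn.1]
  have hAr : 0 < μ.real A := ENNReal.toReal_pos hA0.ne' hAf.ne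
  set I := ∫ x, f x ∂μ with hIdef
  set c := μ.real A / I with hc
  have hc0 : 0 < c := div_pos hAr hI
  have hcI : c * I = μ.real A := div_mul_cancel₀ _ hI.ne'
  have hAm : Measurable (A.indicator (1 : X → ℝ)) := measurable_one.indicator hA
  have hAi : Integrable (A.indicator (1 : X → ℝ)) μ :=
    (integrable_indicator_iff hA).2 (integrableOn_const hAf.ne)
  have hupp := he.ae_exists_symmBirkhoffSum_le_add hAm hfm hAi hf (c := 1) (d := 101 / 100 * c)
    (by rw [integral_indicator_one hA, ← hIdef]; linarith)
  have hlow := he.ae_exists_symmBirkhoffSum_le_add hfm hAm hf hAi (c := 99 / 100 * c) (d := 1)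
    (by rw [integral_indicator_one hA, ← hIdef]; linarith)
  have hcL : 0 < c * L := mul_pos hc0 hL
  -- With 98/100 cL a_n as the new sequence, the lower bound 99/100 cL a_n and the upper bound
  -- (101/100)² cL a_n leave room to absorb K and K', because (101/100)² < 9/8 · 98/100.
  refine not_ae_symmBirkhoffSum_indicator_bounds hcons he hμ
    (ha.const_mul_atTop (show 0 < 98 / 100 * (c * L) by positivity)) hA hAf.ne hA0.ne' ?_
  filter_upwards [hupp, hlow] with x ⟨K, hK⟩ ⟨K', hK'⟩ hxA
  filter_upwards [hAP hxA, ha.eventually_ge_atTop 0,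
    (ha.const_mul_atTop hcL).eventually_ge_atTop (100 * (|K| + |K'|))] with n hn hn0 hnK
  have h1 := hK n
  have h2 := hK' n
  have h3 := mul_le_mul_of_nonneg_left hn.1 hc0.le
  have h4 := mul_le_mul_of_nonneg_left (hn.2.trans (mul_le_mul_of_nonneg_right hU hn0)) hc0.le
  have h5 := le_abs_self K
  have h6 := le_abs_self K'
  have h7 := abs_nonneg K
  have h8 := abs_nonneg K'
  constructor <;> linarith

end Main

theorem theorem1 {X : Type*} [MeasurableSpace X] (μ : Measure X) [SigmaFinite μ]
    (hμ : μ Set.univ = ⊤) (T : X ≃ᵐ X) (hcons : Conservative T μ) (herg : Ergodic T μ)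
    (a : ℕ → ℝ) (ha : Tendsto a atTop atTop)
    (f : X → ℝ) (hf : Integrable f μ) (hf0 : 0 ≤ᵐ[μ] f) :
    ∀ᵐ x ∂μ, 0 < lowerSymmLimit T f a x → lowerSymmLimit T f a x < ⊤ →
      lowerSymmLimit T f a x / upperSymmLimit T f a x ≤ ((10001 / 10002 : ℝ) : EReal) := by
  obtain ⟨g, hgm, hfg⟩ := hf.aestronglyMeasurable.aemeasurable
  have hg : Integrable g μ := hf.congr hfg
  have hg0 : 0 ≤ᵐ[μ] g := by filter_upwards [hf0, hfg] with x h1 h2 using h2 ▸ h1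
  have key : ∀ᵐ x ∂μ, ∀ L U : ℚ, (0 : ℝ) < L → (U : ℝ) ≤ 101 / 100 * L →
      ¬ ∀ᶠ n in atTop, L * a n ≤ symmBirkhoffSum T g n x ∧ symmBirkhoffSum T g n x ≤ U * a n := by
    simp only [ae_all_iff]
    exact fun L U hL hU => ae_not_eventually_symmBirkhoffSum_bounds hcons herg hμ ha hgm hg hg0 hL hU
  filter_upwards [key, symmBirkhoffSum_congr_ae herg.toMeasurePreserving hfg] with x hx hxfg h0 htop
  by_contra! hcon
  have hle : lowerSymmLimit T f a x ≤ upperSymmLimit T f a x := liminf_le_limsup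
  have hutop : upperSymmLimit T f a x ≠ ⊤ := by
    intro h
    rw [h, EReal.div_top] at hcon
    have : (0 : EReal) ≤ ((10001 / 10002 : ℝ) : EReal) := by
      exact_mod_cast (by norm_num : (0 : ℝ) ≤ 10001 / 10002)
    exact absurd hcon (not_lt.2 this)
  obtain ⟨l, hl⟩ : ∃ l : ℝ, lowerSymmLimit T f a x = l :=
    ⟨_, (EReal.coe_toReal htop.ne (ne_bot_of_gt h0)).symm⟩
  obtain ⟨u, hu⟩ : ∃ u : ℝ, upperSymmLimit T f a x = u :=
    ⟨_, (EReal.coe_toReal hutop (ne_bot_of_gt (h0.trans_le hle))).symm⟩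
  rw [hl, hu, ← EReal.coe_div, EReal.coe_lt_coe_iff] at hcon
  rw [hl] at h0
  rw [hl, hu, EReal.coe_le_coe_iff] at hle
  have hl0 : 0 < l := by exact_mod_cast h0
  have hu0 : 0 < u := hl0.trans_le hle
  rw [lt_div_iff₀ hu0] at hcon
  -- Rational bounds keep the exceptional null sets countable in number; 10002/10001 < 101/100
  -- leaves room for U.
  obtain ⟨L, hL1, hL2⟩ := exists_rat_btwn hcon
  obtain ⟨U, hU1, hU2⟩ := exists_rat_btwn (show u < 101 / 100 * L by linarith)
  refine hx L U (by linarith) hU2.le ?_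
  have hlow : ∀ᶠ n in atTop, ((L : ℝ) : EReal) < ((symmBirkhoffSum T f n x / a n : ℝ) : EReal) :=
    eventually_lt_of_lt_liminf (by
      change _ < lowerSymmLimit T f a x
      rw [hl]; exact EReal.coe_lt_coe_iff.2 hL2)
  have hupp : ∀ᶠ n in atTop, ((symmBirkhoffSum T f n x / a n : ℝ) : EReal) < ((U : ℝ) : EReal) :=
    eventually_lt_of_limsup_lt (by
      change upperSymmLimit T f a x < _
      rw [hu]; exact EReal.coe_lt_coe_iff.2 hU1)
  filter_upwards [hlow, hupp, ha.eventually_gt_atTop 0] with n h1 h2 h3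
  rw [EReal.coe_lt_coe_iff, lt_div_iff₀ h3, hxfg n] at h1
  rw [EReal.coe_lt_coe_iff, div_lt_iff₀ h3, hxfg n] at h2
  exact ⟨h1.le, h2.le⟩
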